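/- Let $k,N,T,q$ be positive integers and let $R,D$ be real numbers such that $kR$ is a non-negative integer, $0\le D\le 1$, $N\ge 2T+1$ and $q\ge \frac{2k(1-D)}{3}+2$. Write $\Sigma=[q]=\{1,\dots,q\}$ and $\tilde\Sigma=\Sigma\cup\{e\}$, where $e\notin\Sigma$ is an erasure symbol. For $\mathbf x\in\Sigma^k$ and $\tilde{\mathbf x}\in\tilde\Sigma^k$ put $\Delta(\mathbf x,\tilde{\mathbf x})=\frac1k\sum_{j=1}^k\Delta(x_j,\tilde x_j)\in[0,\infty]$, where $\Delta(x,\tilde x)=0$ if $\tilde x=x$, $\Delta(x,\tilde x)=1$ if $\tilde x=e$, and $\Delta(x,\tilde x)=\infty$ otherwise. For encoding functions $f_1,\dots,f_N:\Sigma^k\to\Sigma^{kR}$, put $\mathbf f_N=(f_1,\dots,f_N)$; for a decoder $g:(\Sigma^{kR})^N\to\tilde\Sigma^k$ and an integer $t\ge 0$, let $D_t(\mathbf f_N,g)$ be the maximum of $\Delta(\mathbf x,g(\mathbf y))$ over all $\mathbf x\in\Sigma^k$ and all $\mathbf y\in(\Sigma^{kR})^N$ that differ from $\mathbf f_N(\mathbf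 x)$ in at most $t$ of the $N$ packets. A $T$-VPEC (variable packet-error coding) code over $[q]$ with parameters $(N,k,R,D)$ is the image of $\mathbf f_N$ for a pair $(\mathbf f_N,g)$ with $D_0(\mathbf f_N,g)=0$ and $D_T(\mathbf f_N,g)\le D$. If there is a $T$-VPEC code over $[q]$ with parameters $(N,k,R,D)$, then $$R\ \ge\ \max\left\{\frac{1-D}{N-2T},\ \frac1{N-T}\right\}.$$ -/

import Mathlib

open scoped ENNReal

namespace VPEC

/-- Single-letter erasure distortion. The reconstruction alphabet `α ∪ {e}` is `Option α`, with
`none` as the erasure symbol `e`. -/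
noncomputable def letterDistortion {α : Type*} [DecidableEq α] (x : α) : Option α → ℝ≥0∞
  | none => 1
  | some y => if x = y then 0 else ∞

/-- Distortion between a source word and a reconstruction: the average of the single-letter
distortions. -/
noncomputable def wordDistortion {α : Type*} [DecidableEq α] {k : ℕ}
    (x : Fin k → α) (y : Fin k → Option α) : ℝ≥0∞ :=
  (∑ j, letterDistortion (x j) (y j)) / (k : ℝ≥0∞)

/-- The encoder `x ↦ (f₁ x, …, f_N x)`, producing `N` packets, each a word of length `m`. -/
def encode {α : Type*} {N k m : ℕ} (f : Fin N → (Fin k → α) → (Fin m → α))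
    (x : Fin k → α) : Fin N → Fin m → α :=
  fun l => f l x

/-- The received packets when `c` is sent and the packets indexed by `A` are replaced by those of
`c'`. -/
def corrupt {α : Type*} {N m : ℕ} (c c' : Fin N → Fin m → α) (A : Finset (Fin N)) :
    Fin N → Fin m → α :=
  fun l => if l ∈ A then c' l else c l

/-- The distortion `D_T` of the coding scheme `(f, g)` under at most `T` packet errors: the worst
case over all source words, all sets of at most `T` packets and all altered values of these. -/
noncomputable def schemeDistortion {α : Type*} [DecidableEq α] {N k m : ℕ} (T : ℕ)
    (f : Fin N → (Fin k → α) → (Fin m → α))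
    (g : (Fin N → Fin m → α) → (Fin k → Option α)) : ℝ≥0∞ :=
  ⨆ (x : Fin k → α) (A : Finset (Fin N)) (_ : A.card ≤ T) (c' : Fin N → Fin m → α),
    wordDistortion x (g (corrupt (encode f x) c' A))

/-- `C ⊆ (α ^ m) ^ N` is a `T`-VPEC code over `α` with parameters `(N, k, R, D)`: the packet length
`m` equals `k R`, and `C` is the image of the encoder of a coding scheme that is lossless without
packet errors and has distortion at most `D` under at most `T` packet errors. -/
def IsVPECCode {α : Type*} [DecidableEq α] {N m : ℕ} (T k : ℕ) (R D : ℝ)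
    (C : Set (Fin N → Fin m → α)) : Prop :=
  (m : ℝ) = k * R ∧
    ∃ (f : Fin N → (Fin k → α) → (Fin m → α)) (g : (Fin N → Fin m → α) → (Fin k → Option α)),
      schemeDistortion 0 f g ≤ 0 ∧
      schemeDistortion T f g ≤ ENNReal.ofReal D ∧
      C = Set.range (encode f)

end VPEC

open Finset

namespace VPEC

/-! ### Families of words with many pairwise agreements -/

section Agreement

variable {α : Type*} [DecidableEq α]

/-! If two source words share their last `N - 2T` packets, corrupting `T` packets of one and `T`
others of the other yields the same received word. The words then agree wherever the decoder does
not erase, so the fibres of these packets consist of words pairwise agreeing in at least `k(1-D)`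
positions. A family with pairwise agreement at least `t` has at most `q^k / (q-1)^t` words
(`card_mul_pow_le`). If `s = m(N-2T) < k(1-D)`, summing over `q^s` fibres gives `(q-1)^(s+1) ≤ q^s`,
which the size of `q` excludes (`succ_pow_lt_pow_succ`). For the bound `1/(N-T)`, lossless decoding
makes the last `N - T` packets determine the word, and counting suffices. -/

/-- The number of positions in which two words agree. -/
def agreement {k : ℕ} (x y : Fin k → α) : ℕ :=
  #{j | x j = y j}

lemma agreement_cons {k : ℕ} (a b : α) (x y : Fin k → α) :
    agreement (Fin.cons a x : Fin (k + 1) → α) (Fin.cons b y) =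
      (if a = b then 1 else 0) + agreement x y := by
  simp only [agreement, Finset.card_filter, Fin.sum_univ_succ, Fin.cons_zero, Fin.cons_succ]

/-- The words of `A` starting with the letter `a`, with this letter removed. -/
def tails [Fintype α] {k : ℕ} (A : Finset (Fin (k + 1) → α)) (a : α) : Finset (Fin k → α) :=
  {x | (Fin.cons a x : Fin (k + 1) → α) ∈ A}

lemma mem_tails [Fintype α] {k : ℕ} {A : Finset (Fin (k + 1) → α)} {a : α} {x : Fin k → α} :
    x ∈ tails A a ↔ (Fin.cons a x : Fin (k + 1) → α) ∈ A := by
  simp [tails]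

lemma sum_card_tails [Fintype α] {k : ℕ} (A : Finset (Fin (k + 1) → α)) :
    ∑ a, #(tails A a) = #A := by
  rw [Finset.card_eq_sum_card_fiberwise (f := fun x : Fin (k + 1) → α => x 0) (t := univ)
    (fun _ _ => by simp)]
  refine Finset.sum_congr rfl fun a _ => ?_
  refine Finset.card_bij (fun x _ => (Fin.cons a x : Fin (k + 1) → α)) ?_ ?_ ?_
  · intro x hx
    simpa using mem_tails.1 hx
  · intro x _ y _ h
    exact (Fin.cons_inj.1 h).2
  · intro z hz
    obtain ⟨hzA, rfl⟩ := Finset.mem_filter.1 hz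
    exact ⟨Fin.tail z, mem_tails.2 (by rwa [Fin.cons_self_tail]), Fin.cons_self_tail z⟩

/-- Inductive step for the size bound, with `u` and `v` counting tails by first letter. The two
largest values of `u` control its sum; multiplying `∑ v` by the maximum of `u` lets the hypotheses
control the other factor. -/
lemma sum_mul_sum_le [Fintype α] {n : ℕ} (hn : 1 ≤ n) (hα : Fintype.card α = n + 1)
    {u v : α → ℝ} {c : ℝ} (hu : ∀ a, 0 ≤ u a) (hv : ∀ a, 0 ≤ v a)
    (hne : ∀ a b, a ≠ b → u a * v b ≤ c) (heq : ∀ a, u a * v a ≤ n ^ 2 * c) :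
    (∑ a, u a) * ∑ a, v a ≤ (n + 1) ^ 2 * c := by
  have : Nonempty α := Fintype.card_pos_iff.1 (by omega)
  obtain ⟨a₀, -, h₀⟩ := Finset.exists_max_image univ u Finset.univ_nonempty
  have hcard : #(univ.erase a₀) = n := by
    rw [Finset.card_erase_of_mem (mem_univ _), Finset.card_univ, hα]; omega
  obtain ⟨a₁, h₁, h₁max⟩ := Finset.exists_max_image (univ.erase a₀) u
    (Finset.card_pos.1 (by omega))
  have hc : 0 ≤ c := (mul_nonneg (hu _) (hv _)).trans (hne a₁ a₀ (Finset.ne_of_mem_erase h₁))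
  have hu_sum : ∑ a, u a ≤ u a₀ + n * u a₁ := by
    rw [← Finset.add_sum_erase _ _ (mem_univ a₀)]
    have := Finset.sum_le_card_nsmul _ _ _ h₁max
    rw [hcard, nsmul_eq_mul] at this
    linarith
  have hv_sum : u a₀ * ∑ a, v a ≤ u a₀ * v a₀ + n * c := by
    rw [← Finset.add_sum_erase _ _ (mem_univ a₀), mul_add, Finset.mul_sum]
    have := Finset.sum_le_card_nsmul (univ.erase a₀) (fun b => u a₀ * v b) c
      fun b hb => hne _ _ (Finset.ne_of_mem_erase hb).symm
    rw [hcard, nsmul_eq_mul] at this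
    linarith
  have hle : u a₁ ≤ u a₀ := h₀ _ (mem_univ _)
  have hcross : u a₁ * v a₀ ≤ c := hne _ _ (Finset.ne_of_mem_erase h₁)
  rcases (hu a₀).eq_or_lt with hM | hM
  · have : ∑ a, u a = 0 := Finset.sum_eq_zero fun a ha => le_antisymm (hM ▸ h₀ a ha) (hu a)
    rw [this, zero_mul]
    positivity
  · refine le_of_mul_le_mul_left ?_ hM
    have hsum0 : 0 ≤ u a₀ * ∑ a, v a := mul_nonneg hM.le (Finset.sum_nonneg fun a _ => hv a)
    have hprod : (u a₀ + n * u a₁) * (u a₀ * v a₀ + n * c) ≤ u a₀ * ((n + 1) ^ 2 * c) := by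
      have key : 0 ≤ (n ^ 2 * c - u a₀ * v a₀) * (u a₀ - u a₁) :=
        mul_nonneg (sub_nonneg.2 (heq a₀)) (sub_nonneg.2 hle)
      have h₂ : u a₀ * (u a₁ * v a₀) ≤ u a₀ * c := mul_le_mul_of_nonneg_left hcross hM.le
      have h₃ := mul_le_mul_of_nonneg_left h₂ (Nat.cast_nonneg (α := ℝ) n)
      linarith
    calc u a₀ * ((∑ a, u a) * ∑ a, v a) = (∑ a, u a) * (u a₀ * ∑ a, v a) := by ring
      _ ≤ (u a₀ + n * u a₁) * (u a₀ * v a₀ + n * c) :=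
        mul_le_mul hu_sum hv_sum hsum0
          (add_nonneg hM.le (mul_nonneg (Nat.cast_nonneg n) (hu a₁)))
      _ ≤ _ := hprod

/-- Size bound for two families of words over an alphabet of size `n + 1`, any word of the one
agreeing with any word of the other in at least `t` positions. -/
theorem card_mul_card_mul_pow_le [Fintype α] {n : ℕ} (hn : 1 ≤ n)
    (hα : Fintype.card α = n + 1) (k t : ℕ) (A B : Finset (Fin k → α))
    (hAB : ∀ x ∈ A, ∀ y ∈ B, t ≤ agreement x y) :
    (#A : ℝ) * #B * (n : ℝ) ^ (2 * t) ≤ ((n : ℝ) + 1) ^ (2 * k) := by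
  have trivialBound (k : ℕ) (A : Finset (Fin k → α)) : (#A : ℝ) ≤ ((n : ℝ) + 1) ^ k := by
    have := Finset.card_le_univ A
    rw [Fintype.card_fun, Fintype.card_fin, hα] at this
    exact_mod_cast this
  induction k generalizing t with
  | zero =>
    rcases A.eq_empty_or_nonempty with rfl | ⟨x, hx⟩
    · simp
    rcases B.eq_empty_or_nonempty with rfl | ⟨y, hy⟩
    · simp
    have ht : t = 0 := by simpa [agreement] using hAB x hx y hy
    subst ht
    simpa using mul_le_mul (trivialBound 0 A) (trivialBound 0 B) (by positivity) (by positivity)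
  | succ k ih =>
    rcases t with _ | t
    · have := mul_le_mul (trivialBound _ A) (trivialBound _ B) (by positivity) (by positivity)
      simpa [two_mul (k + 1), pow_add _ (k + 1) (k + 1)] using this
    have hn0 : (0 : ℝ) < n := by exact_mod_cast hn
    have hpow : (0 : ℝ) < (n : ℝ) ^ (2 * (t + 1)) := by positivity
    -- Different first letters leave all `t + 1` agreements to the tails; equal ones leave `t`,
    -- costing the factor `n ^ 2`. Tails under different letters are compared, hence two families.
    have hsum := sum_mul_sum_le hn hα (u := fun a => (#(tails A a) : ℝ))
      (v := fun a => (#(tails B a) : ℝ))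
      (c := ((n : ℝ) + 1) ^ (2 * k) / (n : ℝ) ^ (2 * (t + 1)))
      (fun _ => by positivity) (fun _ => by positivity)
      (fun a b hab => by
        rw [le_div_iff₀ hpow]
        refine ih (t + 1) _ _ fun x hx y hy => ?_
        simpa [agreement_cons, hab] using hAB _ (mem_tails.1 hx) _ (mem_tails.1 hy))
      (fun a => by
        have := ih t (tails A a) (tails B a) fun x hx y hy => by
          have := hAB _ (mem_tails.1 hx) _ (mem_tails.1 hy)
          rw [agreement_cons, if_pos rfl] at this
          omega
        rw [← mul_div_assoc, le_div_iff₀ hpow]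
        refine Eq.trans_le ?_ (mul_le_mul_of_nonneg_left this (sq_nonneg (n : ℝ)))
        ring)
    rw [← Nat.cast_sum, ← Nat.cast_sum, sum_card_tails, sum_card_tails, ← mul_div_assoc,
      le_div_iff₀ hpow] at hsum
    refine hsum.trans_eq ?_
    ring

/-- Size bound for a family of words over an alphabet of size `n + 1` that pairwise agree in at
least `t` positions. -/
theorem card_mul_pow_le [Fintype α] {n : ℕ} (hn : 1 ≤ n) (hα : Fintype.card α = n + 1)
    (k t : ℕ) (A : Finset (Fin k → α)) (hA : ∀ x ∈ A, ∀ y ∈ A, t ≤ agreement x y) :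
    #A * n ^ t ≤ (n + 1) ^ k := by
  have h := card_mul_card_mul_pow_le hn hα k t A A hA
  have h' : #A * #A * n ^ (2 * t) ≤ (n + 1) ^ (2 * k) := by exact_mod_cast h
  refine (Nat.pow_le_pow_iff_left two_ne_zero).1 ?_
  calc (#A * n ^ t) ^ 2 = #A * #A * n ^ (2 * t) := by ring
    _ ≤ _ := h'
    _ = _ := by ring

end Agreement

/-! ### Numerical inequality for the alphabet size -/

/-- For `n ≥ 5`, `(1 + 1/n)^(2s) ≤ e^3 < 25 ≤ n^2`; smaller `n` leave finitely many cases. -/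
lemma succ_pow_lt_pow_succ {n s : ℕ} (hs : 2 * s < 3 * (n - 1)) : (n + 1) ^ s < n ^ (s + 1) := by
  rcases le_or_gt n 4 with h4 | h5
  · have hn : 2 ≤ n := by omega
    interval_cases n
    all_goals
      have hs4 : s ≤ 4 := by omega
      interval_cases s <;> omega
  · have hn0 : (0 : ℝ) < n := by exact_mod_cast (by omega : 0 < n)
    have hbase : (1 + 1 / (n : ℝ)) ^ (2 * s) < (n : ℝ) ^ 2 := by
      have hexp : 1 + 1 / (n : ℝ) ≤ Real.exp (1 / n) := by
        linarith [Real.add_one_le_exp (1 / (n : ℝ))]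
      have h1 : (1 : ℝ) ≤ 1 + 1 / (n : ℝ) := by
        have : 0 ≤ 1 / (n : ℝ) := by positivity
        linarith
      calc (1 + 1 / (n : ℝ)) ^ (2 * s) ≤ (1 + 1 / (n : ℝ)) ^ (n * 3) :=
            pow_le_pow_right₀ h1 (by omega)
        _ ≤ Real.exp (1 / n) ^ (n * 3) := pow_le_pow_left₀ (by positivity) hexp _
        _ = Real.exp 1 ^ 3 := by
            rw [pow_mul, ← Real.exp_nat_mul, mul_one_div_cancel hn0.ne']
        _ ≤ 2.72 ^ 3 :=
            pow_le_pow_left₀ (Real.exp_pos _).le (by linarith [Real.exp_one_lt_d9]) _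
        _ < 5 ^ 2 := by norm_num
        _ ≤ (n : ℝ) ^ 2 := pow_le_pow_left₀ (by norm_num) (by exact_mod_cast h5) _
    have hlt : (1 + 1 / (n : ℝ)) ^ s < n := by
      refine lt_of_pow_lt_pow_left₀ 2 hn0.le ?_
      rwa [← pow_mul, mul_comm s]
    have hmul := mul_lt_mul_of_pos_right hlt (pow_pos hn0 s)
    rw [← mul_pow, add_mul, one_div_mul_cancel hn0.ne', one_mul, ← pow_succ'] at hmul
    exact_mod_cast hmul

/-! ### Decoding constraints and confusable words -/

section Scheme

variable {α : Type*} [DecidableEq α] {N k m : ℕ}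

lemma wordDistortion_le_schemeDistortion {T : ℕ} (f : Fin N → (Fin k → α) → (Fin m → α))
    (g : (Fin N → Fin m → α) → (Fin k → Option α)) (x : Fin k → α) {A : Finset (Fin N)}
    (hA : #A ≤ T) (c' : Fin N → Fin m → α) :
    wordDistortion x (g (corrupt (encode f x) c' A)) ≤ schemeDistortion T f g :=
  le_iSup_of_le x <| le_iSup_of_le A <| le_iSup_of_le hA <| le_iSup_of_le c' le_rfl

lemma letterDistortion_ne_top_of_wordDistortion {x : Fin k → α} {y : Fin k → Option α}
    (h : wordDistortion x y ≠ ∞) (j : Fin k) : letterDistortion (x j) (y j) ≠ ∞ := by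
  intro hj
  refine h ?_
  rw [wordDistortion, ENNReal.sum_eq_top.2 ⟨j, mem_univ _, hj⟩]
  exact ENNReal.top_div_of_ne_top (ENNReal.natCast_ne_top k)

lemma eq_of_wordDistortion_ne_top {x : Fin k → α} {y : Fin k → Option α}
    (h : wordDistortion x y ≠ ∞) {j : Fin k} {a : α} (hj : y j = some a) : x j = a := by
  by_contra hne
  exact letterDistortion_ne_top_of_wordDistortion h j (by simp [letterDistortion, hj, hne])

lemma card_erasures_le {x : Fin k → α} {y : Fin k → Option α} {D : ℝ} (hk : 0 < k) (hD : 0 ≤ D)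
    (h : wordDistortion x y ≤ ENNReal.ofReal D) : (#{j | y j = none} : ℝ) ≤ k * D := by
  have hsum : (#{j | y j = none} : ℝ≥0∞) ≤ ∑ j, letterDistortion (x j) (y j) := by
    rw [Finset.card_filter, Nat.cast_sum]
    refine Finset.sum_le_sum fun j _ => ?_
    split_ifs with hj
    · simp [letterDistortion, hj]
    · simp
  rw [wordDistortion, ENNReal.div_le_iff (by exact_mod_cast hk.ne') (ENNReal.natCast_ne_top k)] at h
  have h' := hsum.trans h
  rw [← ENNReal.ofReal_natCast, ← ENNReal.ofReal_natCast k, ← ENNReal.ofReal_mul hD,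
    ENNReal.ofReal_le_ofReal_iff (by positivity)] at h'
  linarith

lemma le_agreement_of_wordDistortion_le {x x' : Fin k → α} {y : Fin k → Option α} {D : ℝ}
    (hk : 0 < k) (hD : 0 ≤ D) (h : wordDistortion x y ≤ ENNReal.ofReal D)
    (h' : wordDistortion x' y ≤ ENNReal.ofReal D) :
    (k : ℝ) * (1 - D) ≤ agreement x x' := by
  have hne := ne_top_of_le_ne_top ENNReal.ofReal_ne_top h
  have hne' := ne_top_of_le_ne_top ENNReal.ofReal_ne_top h'
  have hsub : ({j | ¬ y j = none} : Finset (Fin k)) ⊆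
      ({j | x j = x' j} : Finset (Fin k)) := by
    intro j hj
    obtain ⟨a, ha⟩ := Option.ne_none_iff_exists'.1 (Finset.mem_filter.1 hj).2
    simp [eq_of_wordDistortion_ne_top hne ha, eq_of_wordDistortion_ne_top hne' ha]
  have hcard := Finset.card_filter_add_card_filter_not (s := (univ : Finset (Fin k)))
    (fun j => y j = none)
  rw [Finset.card_univ, Fintype.card_fin] at hcard
  have hle : k ≤ #{j | y j = none} + agreement x x' := by
    have := Finset.card_le_card hsub
    rw [agreement]
    omega
  have hle' : (k : ℝ) ≤ #{j | y j = none} + agreement x x' := by exact_mod_cast hle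
  linarith [card_erasures_le hk hD h]

lemma decode_encode {f : Fin N → (Fin k → α) → (Fin m → α)}
    {g : (Fin N → Fin m → α) → (Fin k → Option α)} (h : schemeDistortion 0 f g ≤ 0)
    (hk : 0 < k) (x : Fin k → α) (j : Fin k) : g (encode f x) j = some (x j) := by
  have hx := (wordDistortion_le_schemeDistortion f g x (A := ∅) (by simp) (encode f x)).trans h
  have hc : corrupt (encode f x) (encode f x) ∅ = encode f x := by
    funext l
    simp [corrupt]
  rw [hc] at hx
  have hcard := card_erasures_le hk le_rfl (by simpa using hx)
  have hj : g (encode f x) j ≠ none := by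
    intro hj
    have : 0 < #{j | g (encode f x) j = none} := Finset.card_pos.2 ⟨j, by simpa using hj⟩
    have : (0 : ℝ) < #{j | g (encode f x) j = none} := by exact_mod_cast this
    linarith
  obtain ⟨a, ha⟩ := Option.ne_none_iff_exists'.1 hj
  rw [ha, eq_of_wordDistortion_ne_top (ne_top_of_le_ne_top ENNReal.zero_ne_top hx) ha]

lemma card_filter_val_lt {T : ℕ} (hT : T ≤ N) : #{l : Fin N | l.val < T} = T := by
  rw [Fin.card_filter_val_lt, min_eq_right hT]

lemma card_subtype_le_val (N s : ℕ) : Fintype.card {l : Fin N // s ≤ l.val} = N - s := by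
  rw [Fintype.card_subtype]
  have := Finset.card_filter_add_card_filter_not (s := (univ : Finset (Fin N)))
    (fun l => l.val < s)
  rw [Fin.card_filter_val_lt, Finset.card_univ, Fintype.card_fin] at this
  simp only [not_lt] at this
  omega

/-- Two source words with the same last `N - T` packets coincide. -/
lemma eq_of_packets_eq {T : ℕ} {D : ℝ} {f : Fin N → (Fin k → α) → (Fin m → α)}
    {g : (Fin N → Fin m → α) → (Fin k → Option α)} (hk : 0 < k) (hT : T ≤ N)
    (h0 : schemeDistortion 0 f g ≤ 0) (hD : schemeDistortion T f g ≤ ENNReal.ofReal D)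
    {x x' : Fin k → α} (h : ∀ l : Fin N, T ≤ l.val → f l x = f l x') : x = x' := by
  have hx := (wordDistortion_le_schemeDistortion f g x (card_filter_val_lt hT).le
    (encode f x')).trans hD
  -- The corrupted word is a valid codeword, which decodes to `x'` without erasures.
  have hc : corrupt (encode f x) (encode f x') {l : Fin N | l.val < T} = encode f x' := by
    funext l
    by_cases hl : l.val < T
    · simp [corrupt, hl]
    · simp [corrupt, hl, encode, h l (not_lt.1 hl)]
  rw [hc] at hx
  funext j
  have hdec := decode_encode h0 hk x' j
  exact eq_of_wordDistortion_ne_top (ne_top_of_le_ne_top ENNReal.ofReal_ne_top hx) hdec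

/-- Two source words with the same last `N - 2 * T` packets agree in at least `k * (1 - D)`
positions. -/
lemma le_agreement_of_packets_eq {T : ℕ} {D : ℝ} {f : Fin N → (Fin k → α) → (Fin m → α)}
    {g : (Fin N → Fin m → α) → (Fin k → Option α)} (hk : 0 < k) (hT : 2 * T ≤ N) (hD0 : 0 ≤ D)
    (hD : schemeDistortion T f g ≤ ENNReal.ofReal D)
    {x x' : Fin k → α} (h : ∀ l : Fin N, 2 * T ≤ l.val → f l x = f l x') :
    (k : ℝ) * (1 - D) ≤ agreement x x' := by
  have hcard : #{l : Fin N | T ≤ l.val ∧ l.val < 2 * T} ≤ T := by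
    have hsub := Finset.card_le_card_of_injOn (s := {l : Fin N | T ≤ l.val ∧ l.val < 2 * T})
      (t := Finset.Ico T (2 * T)) (fun l => l.val) (fun l hl => by simpa using hl)
      (Fin.val_injective.injOn)
    rw [Nat.card_Ico] at hsub
    omega
  have hx := (wordDistortion_le_schemeDistortion f g x
    (card_filter_val_lt (by omega : T ≤ N)).le (encode f x')).trans hD
  have hx' := (wordDistortion_le_schemeDistortion f g x' hcard (encode f x)).trans hD
  have hc : corrupt (encode f x) (encode f x') {l : Fin N | l.val < T} =
      corrupt (encode f x') (encode f x) {l : Fin N | T ≤ l.val ∧ l.val < 2 * T} := by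
    funext l
    by_cases h₁ : l.val < T
    · simp [corrupt, h₁, not_le.2 h₁]
    · by_cases h₂ : l.val < 2 * T
      · simp [corrupt, h₁, h₂, not_lt.1 h₁]
      · simp [corrupt, h₁, h₂, encode, h l (not_lt.1 h₂)]
  rw [hc] at hx
  exact le_agreement_of_wordDistortion_le hk hD0 hx hx'

end Scheme

/-! ### Counting packets -/

lemma length_le_packets {q N k m T : ℕ} {D : ℝ} (hq : 2 ≤ q)
    {f : Fin N → (Fin k → Fin q) → (Fin m → Fin q)}
    {g : (Fin N → Fin m → Fin q) → (Fin k → Option (Fin q))} (hk : 0 < k) (hT : T ≤ N)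
    (h0 : schemeDistortion 0 f g ≤ 0) (hD : schemeDistortion T f g ≤ ENNReal.ofReal D) :
    k ≤ m * (N - T) := by
  have hinj : Function.Injective
      (fun (x : Fin k → Fin q) (l : {l : Fin N // T ≤ l.val}) => f l x) := fun x x' h =>
    eq_of_packets_eq hk hT h0 hD fun l hl => congrFun h ⟨l, hl⟩
  have hcard := Fintype.card_le_of_injective _ hinj
  simp only [Fintype.card_fun, Fintype.card_fin, card_subtype_le_val, ← pow_mul] at hcard
  exact (Nat.pow_le_pow_iff_right hq).1 hcard

lemma length_mul_le_packets {q N k m T : ℕ} {D : ℝ}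
    (hq : 2 * (k : ℝ) * (1 - D) / 3 + 2 ≤ (q : ℝ))
    {f : Fin N → (Fin k → Fin q) → (Fin m → Fin q)}
    {g : (Fin N → Fin m → Fin q) → (Fin k → Option (Fin q))} (hk : 0 < k) (hT : 2 * T ≤ N)
    (hD0 : 0 ≤ D) (hD : schemeDistortion T f g ≤ ENNReal.ofReal D) :
    (k : ℝ) * (1 - D) ≤ (m * (N - 2 * T) : ℕ) := by
  by_contra! hlt
  set s := m * (N - 2 * T) with hs
  have hsq : 2 * s + 6 < 3 * q := by
    have : 2 * (s : ℝ) + 6 < 3 * q := by linarith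
    exact_mod_cast this
  obtain ⟨n, rfl⟩ : ∃ n, q = n + 1 := ⟨q - 1, by omega⟩
  let F : (Fin k → Fin (n + 1)) → ({l : Fin N // 2 * T ≤ l.val} → Fin m → Fin (n + 1)) :=
    fun x l => f l x
  have hfiber (c) : #{x | F x = c} * n ^ (s + 1) ≤ (n + 1) ^ k := by
    -- Agreement is an integer exceeding `s`, hence at least `s + 1`; this extra factor `n` gives
    -- the contradiction.
    refine card_mul_pow_le (by omega) (by simp) k (s + 1) _ fun x hx x' hx' => ?_
    have hFx : F x = F x' := by
      rw [(Finset.mem_filter.1 hx).2, (Finset.mem_filter.1 hx').2]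
    have := le_agreement_of_packets_eq hk hT hD0 hD (x := x) (x' := x')
      fun l hl => congrFun hFx ⟨l, hl⟩
    have : (s : ℝ) < agreement x x' := hlt.trans_le this
    exact_mod_cast this
  have htotal : (n + 1) ^ k * n ^ (s + 1) ≤ (n + 1) ^ s * (n + 1) ^ k := by
    have hcard : (n + 1) ^ k = ∑ c, #{x | F x = c} := by
      rw [← Finset.card_eq_sum_card_fiberwise (fun _ _ => by simp)]
      simp
    have hsum := Finset.sum_le_card_nsmul univ (fun c => #{x | F x = c} * n ^ (s + 1))
      ((n + 1) ^ k) fun c _ => hfiber c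
    rw [← Finset.sum_mul, ← hcard, Finset.card_univ] at hsum
    simpa only [Fintype.card_fun, Fintype.card_fin, card_subtype_le_val, ← pow_mul, ← hs,
      smul_eq_mul] using hsum
  have hpow : (n + 1) ^ s < n ^ (s + 1) := succ_pow_lt_pow_succ (by omega)
  rw [mul_comm] at htotal
  exact absurd (Nat.le_of_mul_le_mul_right htotal (by positivity)) (not_le.2 hpow)

end VPEC

theorem corollary1 (q k N T m : ℕ) (R D : ℝ) (hk : 0 < k) (hD0 : 0 ≤ D) (hD1 : D ≤ 1)
    (hN : 2 * T + 1 ≤ N) (hq : 2 * (k : ℝ) * (1 - D) / 3 + 2 ≤ (q : ℝ))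
    (C : Set (Fin N → Fin m → Fin q)) (hC : VPEC.IsVPECCode T k R D C) :
    max ((1 - D) / ((N : ℝ) - 2 * (T : ℝ))) (1 / ((N : ℝ) - (T : ℝ))) ≤ R := by
  obtain ⟨hm, f, g, h0, hD, -⟩ := hC
  have hk0 : (0 : ℝ) < k := by exact_mod_cast hk
  have hN' : 2 * (T : ℝ) + 1 ≤ N := by exact_mod_cast hN
  have hT0 : (0 : ℝ) ≤ T := Nat.cast_nonneg T
  have hq2 : 2 ≤ q := by
    have : 0 ≤ 2 * (k : ℝ) * (1 - D) / 3 :=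
      div_nonneg (mul_nonneg (by positivity) (sub_nonneg.2 hD1)) (by norm_num)
    have : (2 : ℝ) ≤ q := by linarith
    exact_mod_cast this
  refine max_le ?_ ?_
  · rw [div_le_iff₀ (by linarith)]
    refine le_of_mul_le_mul_left ?_ hk0
    have h := VPEC.length_mul_le_packets hq hk (by omega : 2 * T ≤ N) hD0 hD
    rw [Nat.cast_mul, Nat.cast_sub (by omega), hm] at h
    push_cast at h
    linarith
  · rw [div_le_iff₀ (by linarith)]
    refine le_of_mul_le_mul_left ?_ hk0
    have h : (k : ℝ) ≤ (m * (N - T) : ℕ) := by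
      exact_mod_cast VPEC.length_le_packets hq2 hk (by omega : T ≤ N) h0 hD
    rw [Nat.cast_mul, Nat.cast_sub (by omega), hm] at h
    linarith
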